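/- Let $n\ge 1$ and let $M$ be an $n\times n$ real matrix with nonnegative entries. For a permutation $\sigma$ of $\{1,\dots,n\}$, say that $\sigma$ gives a positive diagonal of $M$ if $M_{i,\sigma(i)}>0$ for all $i$; positive diagonals are counted by their permutations. Assume that $M$ has at least one positive diagonal. Put $T^{(0)}=M$ and, for $k\ge 0$, let $L^{(k+1)}$ be obtained from $T^{(k)}$ by dividing each row by its sum, and $T^{(k+1)}$ from $L^{(k+1)}$ by dividing each column by its sum (these are the Bayesian updates $L_{d,h}=T_{d,h}a_h/\sum_{h'}T_{d,h'}a_{h'}$ and $T_{d,h}=L_{d,h}b_d/\sum_{d'}L_{d',h}b_{d'}$ with uniform priors $a_h=b_d=1/n$). Then the limits $L^{(\infty)}=\lim_k L^{(k)}$ and $T^{(\infty)}=\lim_k T^{(k)}$ exist, and with the cooperative index $$\mathrm{CI}(M)=\frac1n\sum_{j=1}^n\sum_{i=1}^n L^{(\infty)}_{i,j}\,T^{(\infty)}_{i,j}$$ the following statements are equivalent: (a) $\mathrm{CI}(M)=1$; (b) $M$ has exactly one positive diagonal; (c) $M$ can be obtained, by permuting rows and permuting columns (independently), from an upper-triangular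 matrix, i.e. a matrix $U$ with $U_{i,i}>0$ for all $i$ and $U_{i,j}=0$ for $i>j$. -/

import Mathlib

open Filter Topology

noncomputable section

namespace CoopInf

variable {D H : Type*} [Fintype D] [Fintype H]

/-- The learner's Bayesian update `P_L(h|d) = P_T(d|h) a(h) / ∑ h', P_T(d|h') a(h')` with prior `a`
on concepts. Rows are indexed by data sets, columns by concepts. A zero row stays zero. -/
def learnerUpdate (a : H → ℝ) (T : Matrix D H ℝ) : Matrix D H ℝ :=
  Matrix.of fun d h => T d h * a h / ∑ h', T d h' * a h'

/-- The teacher's update `P_T(d|h) = P_L(h|d) b(d) / ∑ d', P_L(h|d') b(d')` with prior `b`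
on data sets. A zero column stays zero. -/
def teacherUpdate (b : D → ℝ) (L : Matrix D H ℝ) : Matrix D H ℝ :=
  Matrix.of fun d h => L d h * b d / ∑ d', L d' h * b d'

/-- The uniform prior. -/
def uniformPrior (X : Type*) [Fintype X] : X → ℝ := fun _ => 1 / (Fintype.card X : ℝ)

/-- The teacher's matrices in the fixed-point iteration with uniform priors:
`T⁽⁰⁾ = M` is the initial likelihood, and `T⁽ᵏ⁺¹⁾` is the teacher's update of `L⁽ᵏ⁺¹⁾`,
which is the learner's update of `T⁽ᵏ⁾`. -/
def teacherIter (M : Matrix D H ℝ) : ℕ → Matrix D H ℝ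
  | 0 => M
  | k + 1 => teacherUpdate (uniformPrior D) (learnerUpdate (uniformPrior H) (teacherIter M k))

/-- The learner's matrices in the iteration; `learnerIter M k` is `L⁽ᵏ⁺¹⁾`, obtained from `T⁽ᵏ⁾`. -/
def learnerIter (M : Matrix D H ℝ) (k : ℕ) : Matrix D H ℝ :=
  learnerUpdate (uniformPrior H) (teacherIter M k)

/-- Convergence of the fixed-point iteration: both sequences of matrices have a limit. -/
def IterConverges (M : Matrix D H ℝ) : Prop :=
  (∃ L : Matrix D H ℝ, Tendsto (learnerIter M) atTop (𝓝 L)) ∧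
    ∃ T : Matrix D H ℝ, Tendsto (teacherIter M) atTop (𝓝 T)

/-- The transmission index. -/
def transmissionIndex (L T : Matrix D H ℝ) : ℝ :=
  1 / (Fintype.card H : ℝ) * ∑ h, ∑ d, L d h * T d h

/-- The cooperative index: the transmission index of the two limit matrices
(meaningful when `IterConverges M`). -/
def cooperativeIndex (M : Matrix D H ℝ) : ℝ :=
  transmissionIndex (limUnder atTop (learnerIter M)) (limUnder atTop (teacherIter M))

/-- The permutation `σ` selects a positive diagonal of the square matrix `M`. -/
def IsPositiveDiagonal {n : ℕ} (M : Matrix (Fin n) (Fin n) ℝ) (σ : Equiv.Perm (Fin n)) : Prop :=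
  ∀ i, 0 < M i (σ i)

/-- Zero below the main diagonal and positive on it. -/
def IsPosUpperTriangular {n : ℕ} (U : Matrix (Fin n) (Fin n) ℝ) : Prop :=
  (∀ i, 0 < U i i) ∧ U.IsUpperTriangular

/-- `M` arises from `U` by permuting rows and permuting columns. -/
def IsPermutationOf {n : ℕ} (M U : Matrix (Fin n) (Fin n) ℝ) : Prop :=
  ∃ ρ τ : Equiv.Perm (Fin n), M = U.submatrix ρ τ

end CoopInf

end

/-! The updates are Sinkhorn's alternating row and column normalisations. For a doubly stochastic
`P` supported where `M` is positive, `∑ P log T⁽ᵏ⁾` is nondecreasing for `k ≥ 1`, since positive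
sums with mean 1 have logarithms of total at most 0. If `P` is the permutation matrix of a positive
diagonal, it is also bounded, which forces the row sums to 1. Hence a subsequential limit `A` is
doubly stochastic, and the choice `P = A` upgrades this to convergence of both sequences to `A`
(`exists_tendsto_iter`).

So the index is `(1/n) ∑ A i j ^ 2`, equal to 1 exactly when `A` is a permutation matrix. Ratios of
diagonal products are invariant, so a second positive diagonal of `M` would survive in the limit;
conversely, Birkhoff's theorem leaves only one possible `A` when the diagonal is unique.
Triangularity is a topological sort of the acyclic digraph of off-diagonal positive entries. -/

namespace CoopInf

/-! ### Unique positive diagonals and triangular form -/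

/-- A self-map of a finite type restricts to a permutation of its periodic points; extend that
permutation by the identity. -/
theorem exists_perm_eq_on_periodicPts {α : Type*} [Finite α] (f : α → α) :
    ∃ π : Equiv.Perm α, (∀ x ∈ Function.periodicPts f, π x = f x) ∧
      ∀ x ∉ Function.periodicPts f, π x = x := by
  classical
  have hb := Function.bijOn_periodicPts f
  let g : α → α := fun x => if x ∈ Function.periodicPts f then f x else x
  have hg : Function.Injective g := by
    intro x y hxy
    simp only [g] at hxy
    split_ifs at hxy with hx hy hy
    · exact hb.injOn hx hy hxy
    · exact absurd (hxy ▸ hb.mapsTo hx) hy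
    · exact absurd (hxy ▸ hb.mapsTo hy) hx
    · exact hxy
  refine ⟨Equiv.ofBijective g (Finite.injective_iff_bijective.mp hg), fun x hx => ?_,
    fun x hx => ?_⟩ <;> simp [g, hx]

theorem exists_iterate_mem_periodicPts {α : Type*} [Finite α] (f : α → α) (x : α) :
    ∃ m, f^[m] x ∈ Function.periodicPts f := by
  obtain ⟨m, k, hne, heq⟩ := Finite.exists_ne_map_eq_of_infinite (fun m => f^[m] x)
  wlog hlt : m < k generalizing m k
  · exact this k m hne.symm heq.symm (by omega)
  refine ⟨m, Function.mk_mem_periodicPts (n := k - m) (by omega) ?_⟩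
  rw [Function.IsPeriodicPt, Function.IsFixedPt, ← Function.iterate_add_apply,
    Nat.sub_add_cancel hlt.le]
  exact heq.symm

variable {n : ℕ}

/-- On a set without minimal element, following positive off-diagonal entries leads into a cycle;
completed by diagonal entries it is a second positive diagonal. -/
theorem wellFounded_of_unique_diagonal {N : Matrix (Fin n) (Fin n) ℝ} (hd : ∀ i, 0 < N i i)
    (hu : ∀ σ, IsPositiveDiagonal N σ → σ = 1) :
    WellFounded fun j i : Fin n => i ≠ j ∧ 0 < N i j := by
  classical
  rw [WellFounded.wellFounded_iff_has_min]
  rintro S ⟨x, hx⟩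
  by_contra! hcon
  choose g hgS hgne hgpos using hcon
  let f : Fin n → Fin n := fun i => if h : i ∈ S then g i h else i
  have hfS : ∀ m, f^[m] x ∈ S := by
    intro m
    induction m with
    | zero => exact hx
    | succ m ih =>
      rw [Function.iterate_succ_apply']
      simp only [f, dif_pos ih]
      exact hgS _ ih
  obtain ⟨π, hπ, hπ'⟩ := exists_perm_eq_on_periodicPts f
  obtain ⟨m, hm⟩ := exists_iterate_mem_periodicPts f x
  have hpos : IsPositiveDiagonal N π := by
    intro i
    by_cases hi : i ∈ Function.periodicPts f
    · rw [hπ i hi]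
      by_cases hS : i ∈ S
      · simpa only [f, dif_pos hS] using hgpos i hS
      · simpa only [f, dif_neg hS] using hd i
    · rw [hπ' i hi]
      exact hd i
  have h1 := hπ _ hm
  rw [hu π hpos] at h1
  simp only [f, dif_pos (hfS m)] at h1
  exact hgne _ (hfS m) h1

theorem exists_triangular_of_unique_diagonal {M : Matrix (Fin n) (Fin n) ℝ}
    (hM : ∀ i j, 0 ≤ M i j) (h : ∃! σ : Equiv.Perm (Fin n), IsPositiveDiagonal M σ) :
    ∃ U : Matrix (Fin n) (Fin n) ℝ, IsPosUpperTriangular U ∧ IsPermutationOf M U := by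
  obtain ⟨σ, hσ, huniq⟩ := h
  let N : Matrix (Fin n) (Fin n) ℝ := M.submatrix id σ
  have hu : ∀ τ, IsPositiveDiagonal N τ → τ = 1 := by
    intro τ hτ
    have := huniq (σ * τ) hτ
    simpa using this
  have hwf := wellFounded_of_unique_diagonal (N := N) hσ hu
  have : IsWellFounded (Fin n) fun j i : Fin n => i ≠ j ∧ 0 < N i j := ⟨hwf⟩
  -- A positive entry off the diagonal lowers the rank from row to column, so sorting by decreasing
  -- rank puts it above the diagonal.
  let r : Fin n → Ordinal.{0}ᵒᵈ := fun i =>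
    OrderDual.toDual (IsWellFounded.rank (fun j i : Fin n => i ≠ j ∧ 0 < N i j) i)
  let s := Tuple.sort r
  have hs : Monotone (r ∘ s) := Tuple.monotone_sort r
  refine ⟨N.submatrix s s, ⟨fun i => hσ (s i), fun a b hab => ?_⟩, s⁻¹, s⁻¹ * σ⁻¹, ?_⟩
  · by_contra hne
    have hpos : 0 < N (s a) (s b) := lt_of_le_of_ne (hM _ _) (Ne.symm hne)
    have hlt : r (s a) < r (s b) := OrderDual.toDual_lt_toDual.mpr
      (IsWellFounded.rank_lt_of_rel (r := fun j i : Fin n => i ≠ j ∧ 0 < N i j)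
        ⟨fun h => (ne_of_gt hab) (s.injective h), hpos⟩)
    exact absurd (hs (le_of_lt hab)) (not_le.mpr hlt)
  · ext i j
    simp [N]

theorem unique_diagonal_of_triangular {M U : Matrix (Fin n) (Fin n) ℝ}
    (hU : IsPosUpperTriangular U) (hMU : IsPermutationOf M U) :
    ∃! σ : Equiv.Perm (Fin n), IsPositiveDiagonal M σ := by
  obtain ⟨ρ, τ, rfl⟩ := hMU
  have key : ∀ π : Equiv.Perm (Fin n), (∀ i, 0 < U i (π i)) → π = 1 := by
    intro π hπ
    have hle : ∀ i, i ≤ π i := fun i => by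
      by_contra! h
      exact (hπ i).ne' (hU.2 h)
    have hmono : ∀ i, π i = i := by
      intro i
      -- Equal totals turn all the inequalities `i ≤ π i` into equalities.
      have hsum : ∑ i : Fin n, (i : ℕ) = ∑ i : Fin n, (π i : ℕ) :=
        (Equiv.sum_comp π fun i => (i : ℕ)).symm
      have := (Finset.sum_eq_sum_iff_of_le (s := Finset.univ)
        (fun i _ => Fin.le_def.mp (hle i))).mp hsum i (Finset.mem_univ i)
      exact (Fin.ext this).symm
    exact Equiv.ext hmono
  refine ⟨τ⁻¹ * ρ, fun i => by simpa using hU.1 (ρ i), fun σ hσ => ?_⟩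
  have := key (τ * σ * ρ⁻¹) fun i => by simpa using hσ (ρ⁻¹ i)
  rw [mul_inv_eq_one] at this
  rw [← this]
  simp

/-! ### Updates as normalisations preserving the support -/

theorem learnerUpdate_uniformPrior_apply (A : Matrix (Fin n) (Fin n) ℝ) (i j : Fin n) :
    learnerUpdate (uniformPrior (Fin n)) A i j = A i j / ∑ j', A i j' := by
  have hn : (n : ℝ) ≠ 0 := Nat.cast_ne_zero.mpr (Fin.pos i).ne'
  simp only [learnerUpdate, uniformPrior, Matrix.of_apply, ← Finset.sum_mul, Fintype.card_fin]
  exact mul_div_mul_right _ _ (one_div_ne_zero hn)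

theorem teacherUpdate_eq_transpose (b : Fin n → ℝ) (A : Matrix (Fin n) (Fin n) ℝ) :
    teacherUpdate b A = (learnerUpdate b A.transpose).transpose := rfl

theorem teacherUpdate_uniformPrior_apply (A : Matrix (Fin n) (Fin n) ℝ) (i j : Fin n) :
    teacherUpdate (uniformPrior (Fin n)) A i j = A i j / ∑ i', A i' j :=
  learnerUpdate_uniformPrior_apply A.transpose j i

/-- `A` is nonnegative with the same positive entries as `M`. -/
def SameSupport (A M : Matrix (Fin n) (Fin n) ℝ) : Prop :=
  ∀ i j, 0 ≤ A i j ∧ (0 < A i j ↔ 0 < M i j)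

theorem SameSupport.transpose {A M : Matrix (Fin n) (Fin n) ℝ} (h : SameSupport A M) :
    SameSupport A.transpose M.transpose := fun i j => h j i

theorem SameSupport.row_sum_pos {A M : Matrix (Fin n) (Fin n) ℝ} (h : SameSupport A M)
    {σ : Equiv.Perm (Fin n)} (hσ : IsPositiveDiagonal M σ) (i : Fin n) : 0 < ∑ j, A i j :=
  Finset.sum_pos' (fun j _ => (h i j).1) ⟨σ i, Finset.mem_univ _, (h i _).2.mpr (hσ i)⟩

theorem IsPositiveDiagonal.transpose {M : Matrix (Fin n) (Fin n) ℝ} {σ : Equiv.Perm (Fin n)}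
    (hσ : IsPositiveDiagonal M σ) : IsPositiveDiagonal M.transpose σ⁻¹ := fun i => by
  simpa using hσ (σ⁻¹ i)

theorem SameSupport.col_sum_pos {A M : Matrix (Fin n) (Fin n) ℝ} (h : SameSupport A M)
    {σ : Equiv.Perm (Fin n)} (hσ : IsPositiveDiagonal M σ) (j : Fin n) : 0 < ∑ i, A i j :=
  h.transpose.row_sum_pos hσ.transpose j

theorem SameSupport.learnerUpdate {A M : Matrix (Fin n) (Fin n) ℝ} (h : SameSupport A M)
    {σ : Equiv.Perm (Fin n)} (hσ : IsPositiveDiagonal M σ) :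
    SameSupport (learnerUpdate (uniformPrior (Fin n)) A) M := by
  intro i j
  have hr := h.row_sum_pos hσ i
  rw [learnerUpdate_uniformPrior_apply, div_pos_iff_of_pos_right hr]
  exact ⟨div_nonneg (h i j).1 hr.le, (h i j).2⟩

theorem SameSupport.teacherUpdate {A M : Matrix (Fin n) (Fin n) ℝ} (h : SameSupport A M)
    {σ : Equiv.Perm (Fin n)} (hσ : IsPositiveDiagonal M σ) :
    SameSupport (teacherUpdate (uniformPrior (Fin n)) A) M := by
  rw [teacherUpdate_eq_transpose]
  exact (h.transpose.learnerUpdate hσ.transpose).transpose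

theorem sum_row_learnerUpdate {A M : Matrix (Fin n) (Fin n) ℝ} (h : SameSupport A M)
    {σ : Equiv.Perm (Fin n)} (hσ : IsPositiveDiagonal M σ) (i : Fin n) :
    ∑ j, CoopInf.learnerUpdate (uniformPrior (Fin n)) A i j = 1 := by
  simp only [learnerUpdate_uniformPrior_apply, ← Finset.sum_div]
  exact div_self (h.row_sum_pos hσ i).ne'

theorem sum_col_teacherUpdate {A M : Matrix (Fin n) (Fin n) ℝ} (h : SameSupport A M)
    {σ : Equiv.Perm (Fin n)} (hσ : IsPositiveDiagonal M σ) (j : Fin n) :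
    ∑ i, CoopInf.teacherUpdate (uniformPrior (Fin n)) A i j = 1 :=
  sum_row_learnerUpdate h.transpose hσ.transpose j

theorem sameSupport_teacherIter {M : Matrix (Fin n) (Fin n) ℝ} (hM : ∀ i j, 0 ≤ M i j)
    {σ : Equiv.Perm (Fin n)} (hσ : IsPositiveDiagonal M σ) (k : ℕ) :
    SameSupport (teacherIter M k) M := by
  induction k with
  | zero => exact fun i j => ⟨hM i j, Iff.rfl⟩
  | succ k ih => exact (ih.learnerUpdate hσ).teacherUpdate hσ

theorem sameSupport_learnerIter {M : Matrix (Fin n) (Fin n) ℝ} (hM : ∀ i j, 0 ≤ M i j)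
    {σ : Equiv.Perm (Fin n)} (hσ : IsPositiveDiagonal M σ) (k : ℕ) :
    SameSupport (learnerIter M k) M :=
  (sameSupport_teacherIter hM hσ k).learnerUpdate hσ

/-! ### Relative entropy -/

/-- The pairing `∑ P log A`; up to a constant it is minus the relative entropy of `P` from `A`. -/
noncomputable def logPairing (P A : Matrix (Fin n) (Fin n) ℝ) : ℝ :=
  ∑ i, ∑ j, P i j * Real.log (A i j)

theorem logPairing_transpose (P A : Matrix (Fin n) (Fin n) ℝ) :
    logPairing P.transpose A.transpose = logPairing P A := Finset.sum_comm

theorem logPairing_learnerUpdate {A M P : Matrix (Fin n) (Fin n) ℝ} (h : SameSupport A M)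
    {σ : Equiv.Perm (Fin n)} (hσ : IsPositiveDiagonal M σ) (hP : ∀ i, ∑ j, P i j = 1)
    (hPM : ∀ i j, P i j ≠ 0 → 0 < M i j) :
    logPairing P (learnerUpdate (uniformPrior (Fin n)) A) =
      logPairing P A - ∑ i, Real.log (∑ j, A i j) := by
  rw [logPairing, logPairing, ← Finset.sum_sub_distrib]
  refine Finset.sum_congr rfl fun i _ => ?_
  have hr := h.row_sum_pos hσ i
  calc ∑ j, P i j * Real.log (learnerUpdate (uniformPrior (Fin n)) A i j)
      = ∑ j, (P i j * Real.log (A i j) - P i j * Real.log (∑ j, A i j)) := by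
        refine Finset.sum_congr rfl fun j _ => ?_
        rcases eq_or_ne (P i j) 0 with h0 | h0
        · simp [h0]
        · rw [learnerUpdate_uniformPrior_apply,
            Real.log_div ((h i j).2.mpr (hPM i j h0)).ne' hr.ne', mul_sub]
    _ = _ := by rw [Finset.sum_sub_distrib, ← Finset.sum_mul, hP, one_mul]

theorem logPairing_teacherUpdate {A M P : Matrix (Fin n) (Fin n) ℝ} (h : SameSupport A M)
    {σ : Equiv.Perm (Fin n)} (hσ : IsPositiveDiagonal M σ) (hP : ∀ j, ∑ i, P i j = 1)
    (hPM : ∀ i j, P i j ≠ 0 → 0 < M i j) :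
    logPairing P (teacherUpdate (uniformPrior (Fin n)) A) =
      logPairing P A - ∑ j, Real.log (∑ i, A i j) := by
  rw [teacherUpdate_eq_transpose, ← logPairing_transpose P, Matrix.transpose_transpose,
    logPairing_learnerUpdate (P := P.transpose) h.transpose hσ.transpose hP fun i j => hPM j i,
    logPairing_transpose]
  rfl

/-- A pointwise comparison of relative entropy with squared Hellinger distance. -/
theorem two_mul_sub_sqrt_le_mul_log {p a : ℝ} (hp : 0 ≤ p) (hpa : p ≠ 0 → 0 < a) :
    2 * (p - √p * √a) ≤ p * Real.log p - p * Real.log a := by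
  rcases hp.eq_or_lt with rfl | hp
  · simp
  have ha := hpa hp.ne'
  have hsp := Real.sqrt_pos.mpr hp
  have hsa := Real.sqrt_pos.mpr ha
  -- Taking `log x ≤ x - 1` at `√a / √p` rather than `a / p` gives the Hellinger bound; the factor 2
  -- comes from `log √x = log x / 2`.
  have h := Real.log_le_sub_one_of_pos (div_pos hsa hsp)
  rw [Real.log_div hsa.ne' hsp.ne', Real.log_sqrt ha.le, Real.log_sqrt hp.le] at h
  have h2 := mul_le_mul_of_nonneg_left h hp.le
  have h3 : p * (√a / √p - 1) = √p * √a - p := by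
    nth_rewrite 1 [← Real.mul_self_sqrt hp.le]
    field_simp
    rw [mul_sub, Real.mul_self_sqrt hp.le]
  rw [h3] at h2
  linarith

theorem sum_sq_sqrt_sub_le {ι : Type*} [Fintype ι] {p a : ι → ℝ} (hp : ∀ i, 0 ≤ p i)
    (ha : ∀ i, 0 ≤ a i) (hpa : ∀ i, p i ≠ 0 → 0 < a i) (hsum : ∑ i, p i = ∑ i, a i) :
    ∑ i, (√(p i) - √(a i)) ^ 2 ≤ ∑ i, p i * Real.log (p i) - ∑ i, p i * Real.log (a i) := by
  calc ∑ i, (√(p i) - √(a i)) ^ 2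
      = ∑ i, (2 * (p i - √(p i) * √(a i)) + (a i - p i)) := by
        refine Finset.sum_congr rfl fun i _ => ?_
        rw [sub_sq, Real.sq_sqrt (hp i), Real.sq_sqrt (ha i)]
        ring
    _ = ∑ i, 2 * (p i - √(p i) * √(a i)) := by
        rw [Finset.sum_add_distrib, Finset.sum_sub_distrib, hsum, sub_self, add_zero]
    _ ≤ ∑ i, (p i * Real.log (p i) - p i * Real.log (a i)) :=
        Finset.sum_le_sum fun i _ => two_mul_sub_sqrt_le_mul_log (hp i) (hpa i)
    _ = _ := Finset.sum_sub_distrib _ _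

/-- Convergence in relative entropy implies pointwise convergence. -/
theorem tendsto_of_tendsto_sum_mul_log {ι : Type*} [Fintype ι] {p : ι → ℝ} {a : ℕ → ι → ℝ}
    (hp : ∀ i, 0 ≤ p i) (ha : ∀ k i, 0 ≤ a k i) (hpa : ∀ k i, p i ≠ 0 → 0 < a k i)
    (hsum : ∀ k, ∑ i, p i = ∑ i, a k i)
    (hlim : Tendsto (fun k => ∑ i, p i * Real.log (a k i)) atTop
      (𝓝 (∑ i, p i * Real.log (p i)))) (i : ι) :
    Tendsto (fun k => a k i) atTop (𝓝 (p i)) := by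
  have h0 : Tendsto (fun k => ∑ i, p i * Real.log (p i) - ∑ i, p i * Real.log (a k i)) atTop
      (𝓝 0) := by
    simpa using hlim.const_sub (∑ i, p i * Real.log (p i))
  have h1 : Tendsto (fun k => (√(p i) - √(a k i)) ^ 2) atTop (𝓝 0) := by
    refine squeeze_zero (fun k => sq_nonneg _) (fun k => ?_) h0
    refine le_trans ?_ (sum_sq_sqrt_sub_le hp (ha k) (hpa k) (hsum k))
    exact Finset.single_le_sum (f := fun i => (√(p i) - √(a k i)) ^ 2)
      (fun i _ => sq_nonneg _) (Finset.mem_univ i)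
  have h2 : Tendsto (fun k => √(p i) - √(a k i)) atTop (𝓝 0) := by
    rw [tendsto_zero_iff_abs_tendsto_zero]
    simpa [Function.comp_def, Real.sqrt_sq_eq_abs] using h1.sqrt
  have h3 : Tendsto (fun k => √(a k i)) atTop (𝓝 √(p i)) := by
    simpa using h2.const_sub √(p i)
  simpa [Real.sq_sqrt, hp, ha] using h3.pow 2

theorem sum_log_nonpos {a : Fin n → ℝ} (ha : ∀ i, 0 < a i) (hsum : ∑ i, a i = n) :
    ∑ i, Real.log (a i) ≤ 0 := by
  calc ∑ i, Real.log (a i) ≤ ∑ i, (a i - 1) :=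
        Finset.sum_le_sum fun i _ => Real.log_le_sub_one_of_pos (ha i)
    _ = 0 := by simp [hsum]

/-! ### Convergence of the iteration -/

section Convergence

variable {M : Matrix (Fin n) (Fin n) ℝ} {σ : Equiv.Perm (Fin n)}

/-- The index is shifted because `T⁽⁰⁾ = M` is not normalised. -/
theorem sum_col_teacherIter_succ (hM : ∀ i j, 0 ≤ M i j) (hσ : IsPositiveDiagonal M σ) (k : ℕ)
    (j : Fin n) : ∑ i, teacherIter M (k + 1) i j = 1 :=
  sum_col_teacherUpdate (sameSupport_learnerIter hM hσ k) hσ j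

theorem sum_sum_teacherIter_succ (hM : ∀ i j, 0 ≤ M i j) (hσ : IsPositiveDiagonal M σ) (k : ℕ) :
    ∑ i, ∑ j, teacherIter M (k + 1) i j = n :=
  Finset.sum_comm.trans (by simp [sum_col_teacherIter_succ hM hσ k])

theorem teacherIter_succ_mem_Icc (hM : ∀ i j, 0 ≤ M i j) (hσ : IsPositiveDiagonal M σ) (k : ℕ)
    (i j : Fin n) : teacherIter M (k + 1) i j ∈ Set.Icc (0 : ℝ) 1 := by
  have h := sameSupport_teacherIter hM hσ (k + 1)
  refine ⟨(h i j).1, ?_⟩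
  rw [← sum_col_teacherIter_succ hM hσ k j]
  exact Finset.single_le_sum (f := fun i => teacherIter M (k + 1) i j)
    (fun i _ => (h i j).1) (Finset.mem_univ i)

theorem sum_log_row_teacherIter_nonpos (hM : ∀ i j, 0 ≤ M i j) (hσ : IsPositiveDiagonal M σ)
    (k : ℕ) : ∑ i, Real.log (∑ j, teacherIter M (k + 1) i j) ≤ 0 :=
  sum_log_nonpos ((sameSupport_teacherIter hM hσ (k + 1)).row_sum_pos hσ)
    (sum_sum_teacherIter_succ hM hσ k)

/-- The column term is dropped by its sign; the row term is kept because it must be shown to vanish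
in the limit. -/
theorem logPairing_teacherIter_step (hM : ∀ i j, 0 ≤ M i j) (hσ : IsPositiveDiagonal M σ)
    {P : Matrix (Fin n) (Fin n) ℝ} (hP : P ∈ doublyStochastic ℝ (Fin n))
    (hPM : ∀ i j, P i j ≠ 0 → 0 < M i j) (k : ℕ) :
    logPairing P (teacherIter M (k + 1)) - ∑ i, Real.log (∑ j, teacherIter M (k + 1) i j) ≤
      logPairing P (teacherIter M (k + 2)) := by
  have hT := sameSupport_teacherIter hM hσ (k + 1)
  have hL := sameSupport_learnerIter hM hσ (k + 1)
  have h1 : logPairing P (learnerIter M (k + 1)) = _ :=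
    logPairing_learnerUpdate hT hσ (sum_row_of_mem_doublyStochastic hP) hPM
  have h2 : logPairing P (teacherIter M (k + 2)) = _ :=
    logPairing_teacherUpdate hL hσ (sum_col_of_mem_doublyStochastic hP) hPM
  change _ = logPairing P (learnerIter M (k + 1)) -
    ∑ j, Real.log (∑ i, learnerIter M (k + 1) i j) at h2
  have h3 : ∑ j, Real.log (∑ i, learnerIter M (k + 1) i j) ≤ 0 := by
    refine sum_log_nonpos (hL.col_sum_pos hσ) ?_
    exact Finset.sum_comm.trans
      ((Finset.sum_congr rfl fun i _ => sum_row_learnerUpdate hT hσ i).trans (by simp))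
  linarith

theorem monotone_logPairing_teacherIter (hM : ∀ i j, 0 ≤ M i j) (hσ : IsPositiveDiagonal M σ)
    {P : Matrix (Fin n) (Fin n) ℝ} (hP : P ∈ doublyStochastic ℝ (Fin n))
    (hPM : ∀ i j, P i j ≠ 0 → 0 < M i j) :
    Monotone fun k => logPairing P (teacherIter M (k + 1)) :=
  monotone_nat_of_le_succ fun k => by
    have h1 := logPairing_teacherIter_step hM hσ hP hPM k
    have h2 := sum_log_row_teacherIter_nonpos hM hσ k
    linarith

theorem permMatrix_apply_eq_ite (σ : Equiv.Perm (Fin n)) (i j : Fin n) :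
    σ.permMatrix ℝ i j = if σ i = j then 1 else 0 := by
  simp [Equiv.Perm.permMatrix, PEquiv.toMatrix_apply, Equiv.toPEquiv_apply, eq_comm]

theorem tendsto_sum_log_row_teacherIter (hM : ∀ i j, 0 ≤ M i j) (hσ : IsPositiveDiagonal M σ) :
    Tendsto (fun k => ∑ i, Real.log (∑ j, teacherIter M (k + 1) i j)) atTop (𝓝 0) := by
  have hP : σ.permMatrix ℝ ∈ doublyStochastic ℝ (Fin n) := permMatrix_mem_doublyStochastic
  have hPM : ∀ i j, σ.permMatrix ℝ i j ≠ 0 → 0 < M i j := by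
    intro i j h
    rw [permMatrix_apply_eq_ite] at h
    have : σ i = j := by
      by_contra h'
      simp [h'] at h
    exact this ▸ hσ i
  have hmono := monotone_logPairing_teacherIter hM hσ hP hPM
  have hbdd : BddAbove (Set.range fun k => logPairing (σ.permMatrix ℝ) (teacherIter M (k + 1))) := by
    refine ⟨0, ?_⟩
    rintro _ ⟨k, rfl⟩
    refine Finset.sum_nonpos fun i _ => Finset.sum_nonpos fun j _ => ?_
    have h := teacherIter_succ_mem_Icc hM hσ k i j
    exact mul_nonpos_of_nonneg_of_nonpos (nonneg_of_mem_doublyStochastic hP)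
      (Real.log_nonpos h.1 h.2)
  have hlim := tendsto_atTop_ciSup hmono hbdd
  -- The increments of a bounded monotone sequence tend to 0, and they dominate the row terms in
  -- absolute value.
  have hdiff := hlim.sub (hlim.comp (tendsto_add_atTop_nat 1))
  rw [sub_self] at hdiff
  refine tendsto_of_tendsto_of_tendsto_of_le_of_le hdiff tendsto_const_nhds (fun k => ?_)
    (sum_log_row_teacherIter_nonpos hM hσ)
  have := logPairing_teacherIter_step hM hσ hP hPM k
  simp only [Function.comp_apply]
  linarith

theorem tendsto_row_sum_teacherIter (hM : ∀ i j, 0 ≤ M i j) (hσ : IsPositiveDiagonal M σ)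
    (i : Fin n) : Tendsto (fun k => ∑ j, teacherIter M (k + 1) i j) atTop (𝓝 1) := by
  have hpos := fun k => (sameSupport_teacherIter hM hσ (k + 1)).row_sum_pos hσ
  -- The sum of logarithms is the entropy pairing with the all-ones vector, whose total is also `n`.
  refine tendsto_of_tendsto_sum_mul_log (p := fun _ => 1)
    (a := fun k i => ∑ j, teacherIter M (k + 1) i j) (fun _ => zero_le_one)
    (fun k i => (hpos k i).le) (fun k i _ => hpos k i) (fun k => ?_) ?_ i
  · rw [sum_sum_teacherIter_succ hM hσ k]
    simp
  · simpa using tendsto_sum_log_row_teacherIter hM hσ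

/-- The iteration started at a nonnegative matrix with a positive diagonal converges, both
sequences having the same doubly stochastic limit. -/
theorem exists_tendsto_iter (hM : ∀ i j, 0 ≤ M i j) (hσ : IsPositiveDiagonal M σ) :
    ∃ A ∈ doublyStochastic ℝ (Fin n), (∀ i j, A i j ≠ 0 → 0 < M i j) ∧
      Tendsto (learnerIter M) atTop (𝓝 A) ∧ Tendsto (teacherIter M) atTop (𝓝 A) := by
  have hK : IsCompact (Set.univ.pi fun _ : Fin n => Set.univ.pi fun _ : Fin n =>
      Set.Icc (0 : ℝ) 1) :=
    isCompact_univ_pi fun _ => isCompact_univ_pi fun _ => isCompact_Icc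
  obtain ⟨A, hA, φ, hφ, hlim⟩ := hK.tendsto_subseq (X := Fin n → Fin n → ℝ)
    (x := fun k => teacherIter M (k + 1))
    fun k i _ j _ => teacherIter_succ_mem_Icc hM hσ k i j
  have hent : ∀ i j, Tendsto (fun m => teacherIter M (φ m + 1) i j) atTop (𝓝 (A i j)) :=
    fun i j => tendsto_pi_nhds.mp (tendsto_pi_nhds.mp hlim i) j
  have hA0 : ∀ i j, 0 ≤ A i j := fun i j => (hA i trivial j trivial).1
  have hrow : ∀ i, ∑ j, A i j = 1 := fun i =>
    tendsto_nhds_unique (tendsto_finsetSum _ fun j _ => hent i j)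
      ((tendsto_row_sum_teacherIter hM hσ i).comp hφ.tendsto_atTop)
  have hcol : ∀ j, ∑ i, A i j = 1 := fun j => by
    refine tendsto_nhds_unique (tendsto_finsetSum _ fun i _ => hent i j) ?_
    simp [sum_col_teacherIter_succ hM hσ]
  have hds : (Matrix.of A) ∈ doublyStochastic ℝ (Fin n) :=
    mem_doublyStochastic_iff_sum.mpr ⟨hA0, hrow, hcol⟩
  have hAM : ∀ i j, A i j ≠ 0 → 0 < M i j := by
    intro i j h
    by_contra h0
    refine h (tendsto_nhds_unique (hent i j) ?_)
    have : ∀ k, teacherIter M k i j = 0 := fun k => by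
      have hs := sameSupport_teacherIter hM hσ k i j
      exact le_antisymm (not_lt.mp fun h' => h0 (hs.2.mp h')) hs.1
    simp [this]
  have hpair : Tendsto (fun k => logPairing (Matrix.of A) (teacherIter M (k + 1))) atTop
      (𝓝 (logPairing (Matrix.of A) (Matrix.of A))) := by
    -- Monotonicity passes the limit along `φ` to the whole sequence.
    rw [tendsto_iff_tendsto_subseq_of_monotone
      (monotone_logPairing_teacherIter hM hσ hds hAM) hφ.tendsto_atTop]
    refine tendsto_finsetSum _ fun i _ => tendsto_finsetSum _ fun j _ => ?_
    rcases eq_or_ne (A i j) 0 with h0 | h0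
    · simp [h0]
    · exact ((hent i j).log h0).const_mul _
  have hT : ∀ i j, Tendsto (fun k => teacherIter M (k + 1) i j) atTop (𝓝 (A i j)) := by
    intro i j
    refine tendsto_of_tendsto_sum_mul_log (p := fun x : Fin n × Fin n => A x.1 x.2)
      (a := fun k x => teacherIter M (k + 1) x.1 x.2) (fun x => hA0 _ _)
      (fun k x => (sameSupport_teacherIter hM hσ (k + 1) _ _).1)
      (fun k x hx => (sameSupport_teacherIter hM hσ (k + 1) _ _).2.mpr (hAM _ _ hx))
      (fun k => ?_) ?_ (i, j)
    · rw [Fintype.sum_prod_type, Fintype.sum_prod_type, sum_sum_teacherIter_succ hM hσ k]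
      simp [hrow]
    · simpa only [logPairing, Matrix.of_apply, Fintype.sum_prod_type] using hpair
  have hL : ∀ i j, Tendsto (fun k => learnerIter M (k + 1) i j) atTop (𝓝 (A i j)) := by
    intro i j
    simp only [learnerIter, learnerUpdate_uniformPrior_apply]
    simpa [Pi.div_def] using (hT i j).div (tendsto_row_sum_teacherIter hM hσ i) one_ne_zero
  refine ⟨Matrix.of A, hds, hAM, (tendsto_add_atTop_iff_nat 1).mp ?_, (tendsto_add_atTop_iff_nat 1).mp ?_⟩
  · exact tendsto_pi_nhds.mpr fun i => tendsto_pi_nhds.mpr fun j => hL i j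
  · exact tendsto_pi_nhds.mpr fun i => tendsto_pi_nhds.mpr fun j => hT i j

end Convergence

/-! ### Diagonal products and permutation limits -/

/-- The quotient of the products along two diagonals is invariant under the iteration. -/
theorem prod_diagonal_mul_prod_diagonal_teacherIter (M : Matrix (Fin n) (Fin n) ℝ)
    (σ τ : Equiv.Perm (Fin n)) (k : ℕ) :
    (∏ i, teacherIter M k i (σ i)) * ∏ i, M i (τ i) =
      (∏ i, teacherIter M k i (τ i)) * ∏ i, M i (σ i) := by
  induction k with
  | zero => exact mul_comm _ _
  | succ k ih =>
    -- A diagonal meets each row and column once, so the divisor does not depend on `π`.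
    have h : ∀ π : Equiv.Perm (Fin n), ∏ i, teacherIter M (k + 1) i (π i) =
        (∏ i, teacherIter M k i (π i)) / (∏ i, ∑ j, teacherIter M k i j) /
          ∏ j, ∑ i, learnerIter M k i j := by
      intro π
      rw [← Equiv.prod_comp π fun j => ∑ i, learnerIter M k i j, ← Finset.prod_div_distrib,
        ← Finset.prod_div_distrib]
      refine Finset.prod_congr rfl fun i _ => ?_
      rw [teacherIter, teacherUpdate_uniformPrior_apply, learnerUpdate_uniformPrior_apply]
      rfl
    rw [h, h, div_mul_eq_mul_div, div_mul_eq_mul_div, div_mul_eq_mul_div, div_mul_eq_mul_div, ih]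

/-- The diagonals carrying weight in a Birkhoff decomposition are positive. -/
theorem apply_pos_of_weight_ne_zero {A : Matrix (Fin n) (Fin n) ℝ} {w : Equiv.Perm (Fin n) → ℝ}
    (hw0 : ∀ σ, 0 ≤ w σ) (hwA : ∑ σ, w σ • σ.permMatrix ℝ = A) {τ : Equiv.Perm (Fin n)}
    (hw : w τ ≠ 0) (i : Fin n) : 0 < A i (τ i) := by
  have hle : w τ * τ.permMatrix ℝ i (τ i) ≤ A i (τ i) := by
    rw [← hwA, Matrix.sum_apply]
    refine Finset.single_le_sum (f := fun π => (w π • π.permMatrix ℝ) i (τ i))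
      (fun π _ => ?_) (Finset.mem_univ τ)
    exact mul_nonneg (hw0 π) (nonneg_of_mem_doublyStochastic permMatrix_mem_doublyStochastic)
  rw [permMatrix_apply_eq_ite, if_pos rfl, mul_one] at hle
  exact lt_of_lt_of_le (lt_of_le_of_ne (hw0 τ) (Ne.symm hw)) hle

theorem eq_permMatrix_of_support {A M : Matrix (Fin n) (Fin n) ℝ}
    (hA : A ∈ doublyStochastic ℝ (Fin n)) (hAM : ∀ i j, A i j ≠ 0 → 0 < M i j)
    {σ : Equiv.Perm (Fin n)} (hu : ∀ τ, IsPositiveDiagonal M τ → τ = σ) :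
    A = σ.permMatrix ℝ := by
  obtain ⟨w, hw0, hw1, hwA⟩ := exists_eq_sum_perm_of_mem_doublyStochastic hA
  have hzero : ∀ τ ≠ σ, w τ = 0 := by
    intro τ hτ
    by_contra hw
    refine hτ (hu τ fun i => hAM i _ ?_)
    exact (apply_pos_of_weight_ne_zero hw0 hwA hw i).ne'
  have hσ1 : w σ = 1 := by
    rw [← hw1]
    exact (Fintype.sum_eq_single σ hzero).symm
  rw [← hwA, Fintype.sum_eq_single σ fun τ hτ => by rw [hzero τ hτ, zero_smul], hσ1, one_smul]

theorem transmissionIndex_permMatrix (hn : 1 ≤ n) (σ : Equiv.Perm (Fin n)) :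
    transmissionIndex (σ.permMatrix ℝ) (σ.permMatrix ℝ) = 1 := by
  have hn' : (n : ℝ) ≠ 0 := Nat.cast_ne_zero.mpr (by omega)
  rw [transmissionIndex, Finset.sum_comm]
  simp [hn']

/-- A doubly stochastic matrix whose squared entries sum to `n` has entries `0` and `1`. -/
theorem eq_zero_or_one_of_transmissionIndex_eq_one (hn : 1 ≤ n) {A : Matrix (Fin n) (Fin n) ℝ}
    (hA : A ∈ doublyStochastic ℝ (Fin n)) (h : transmissionIndex A A = 1) (i j : Fin n) :
    A i j = 0 ∨ A i j = 1 := by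
  have hn' : (n : ℝ) ≠ 0 := Nat.cast_ne_zero.mpr (by omega)
  have h1 : ∑ j, ∑ i, A i j * A i j = n := by
    rw [transmissionIndex, Fintype.card_fin] at h
    field_simp at h
    simpa [sq] using h
  -- Entries and squared entries both total `n`, and each summand is nonnegative.
  have h2 : ∑ j, ∑ i, A i j * (1 - A i j) = 0 := by
    simp only [mul_sub, mul_one, Finset.sum_sub_distrib, h1, sum_col_of_mem_doublyStochastic hA]
    simp
  have hnn : ∀ i j, 0 ≤ A i j * (1 - A i j) := fun i j =>
    mul_nonneg (nonneg_of_mem_doublyStochastic hA)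
      (sub_nonneg.mpr (le_one_of_mem_doublyStochastic hA))
  have h3 := (Finset.sum_eq_zero_iff_of_nonneg fun j _ =>
    Finset.sum_nonneg fun i _ => hnn i j).mp h2 j (Finset.mem_univ j)
  have h4 := (Finset.sum_eq_zero_iff_of_nonneg fun i _ => hnn i j).mp h3 i (Finset.mem_univ i)
  rcases mul_eq_zero.mp h4 with h5 | h5
  · exact Or.inl h5
  · exact Or.inr (by linarith)

/-- Any permutation with Birkhoff weight meets only positive entries, hence ones, which exhaust the
row sums. -/
theorem exists_eq_permMatrix_of_transmissionIndex_eq_one (hn : 1 ≤ n)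
    {A : Matrix (Fin n) (Fin n) ℝ} (hA : A ∈ doublyStochastic ℝ (Fin n))
    (h : transmissionIndex A A = 1) : ∃ σ : Equiv.Perm (Fin n), A = σ.permMatrix ℝ := by
  obtain ⟨w, hw0, hw1, hwA⟩ := exists_eq_sum_perm_of_mem_doublyStochastic hA
  obtain ⟨σ, -, hσ⟩ := Finset.exists_ne_zero_of_sum_ne_zero (hw1.trans_ne one_ne_zero)
  have hone : ∀ i, A i (σ i) = 1 := by
    intro i
    refine (eq_zero_or_one_of_transmissionIndex_eq_one hn hA h i (σ i)).resolve_left ?_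
    exact (apply_pos_of_weight_ne_zero hw0 hwA hσ i).ne'
  refine ⟨σ, ?_⟩
  ext i j
  rw [permMatrix_apply_eq_ite]
  split_ifs with hij
  · exact hij ▸ hone i
  · have hsum := sum_row_of_mem_doublyStochastic hA i
    rw [← Finset.add_sum_erase _ _ (Finset.mem_univ (σ i)), hone i, add_eq_left] at hsum
    exact (Finset.sum_eq_zero_iff_of_nonneg fun _ _ => nonneg_of_mem_doublyStochastic hA).mp hsum j
      (Finset.mem_erase.mpr ⟨Ne.symm hij, Finset.mem_univ j⟩)

/-- If the iteration converges to a permutation matrix, no other diagonal of the initial matrix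
is positive. -/
theorem eq_of_tendsto_permMatrix {M : Matrix (Fin n) (Fin n) ℝ} {σ τ : Equiv.Perm (Fin n)}
    (hlim : Tendsto (teacherIter M) atTop (𝓝 (σ.permMatrix ℝ)))
    (hτ : IsPositiveDiagonal M τ) : τ = σ := by
  have hprod : ∀ π : Equiv.Perm (Fin n), Tendsto (fun k => ∏ i, teacherIter M k i (π i)) atTop
      (𝓝 (∏ i, σ.permMatrix ℝ i (π i))) := fun π =>
    tendsto_finsetProd _ fun i _ => tendsto_pi_nhds.mp (tendsto_pi_nhds.mp hlim i) (π i)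
  have heq := tendsto_nhds_unique
    (((hprod σ).mul_const (∏ i, M i (τ i))).congr fun k =>
      prod_diagonal_mul_prod_diagonal_teacherIter M σ τ k)
    ((hprod τ).mul_const (∏ i, M i (σ i)))
  have hM : 0 < ∏ i, M i (τ i) := Finset.prod_pos fun i _ => hτ i
  have hne : ∏ i, σ.permMatrix ℝ i (τ i) ≠ 0 := by
    intro h0
    rw [h0, zero_mul] at heq
    simp only [permMatrix_apply_eq_ite, if_true, Finset.prod_const_one, one_mul] at heq
    exact hM.ne' heq
  ext i
  by_contra hi
  refine hne (Finset.prod_eq_zero (Finset.mem_univ i) ?_)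
  rw [permMatrix_apply_eq_ite, if_neg fun h => hi (congrArg Fin.val h.symm)]

end CoopInf

open CoopInf

theorem theorem2 (n : ℕ) (hn : 1 ≤ n) (M : Matrix (Fin n) (Fin n) ℝ)
    (hM : ∀ i j, 0 ≤ M i j)
    (hdiag : ∃ σ : Equiv.Perm (Fin n), CoopInf.IsPositiveDiagonal M σ) :
    CoopInf.IterConverges M ∧
      List.TFAE [
        CoopInf.cooperativeIndex M = 1,
        ∃! σ : Equiv.Perm (Fin n), CoopInf.IsPositiveDiagonal M σ,
        ∃ U : Matrix (Fin n) (Fin n) ℝ,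
          CoopInf.IsPosUpperTriangular U ∧ CoopInf.IsPermutationOf M U] := by
  obtain ⟨σ₀, hσ₀⟩ := hdiag
  obtain ⟨A, hA, hAM, hL, hT⟩ := exists_tendsto_iter hM hσ₀
  have hCI : cooperativeIndex M = transmissionIndex A A := by
    rw [cooperativeIndex, hL.limUnder_eq, hT.limUnder_eq]
  refine ⟨⟨⟨A, hL⟩, A, hT⟩, ?_⟩
  tfae_have 1 → 2 := by
    intro h
    obtain ⟨σ, rfl⟩ := exists_eq_permMatrix_of_transmissionIndex_eq_one hn hA (hCI ▸ h)
    exact ⟨σ₀, hσ₀, fun τ hτ =>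
      (eq_of_tendsto_permMatrix hT hτ).trans (eq_of_tendsto_permMatrix hT hσ₀).symm⟩
  tfae_have 2 → 1 := by
    rintro ⟨σ, -, hu⟩
    rw [hCI, eq_permMatrix_of_support hA hAM hu]
    exact transmissionIndex_permMatrix hn σ
  tfae_have 2 → 3 := exists_triangular_of_unique_diagonal hM
  tfae_have 3 → 2 := fun ⟨_, hU, hMU⟩ => unique_diagonal_of_triangular hU hMU
  tfae_finish
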